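/- For integers $l,m,n$ let $P(l,m,n)$ be the three-strand pretzel link, given by its standard diagram: three columns of $|l|,|m|,|n|$ crossings between two vertical strands, a column being right-handed if its integer is positive and left-handed if it is negative, with cyclically neighbouring columns joined at the top and at the bottom by arcs. For $l\ge 2$ let $P(-l,l,0)_{LR}$ be $P(-l,l,0)$ oriented so that, at the top, the arc from the first to the second column points left, the arc from the second to the third column points right, and the right strand of the third column points up; equivalently (up to reversing all components) the two strands of each of the first two columns are parallel and those of the third are antiparallel. For even $l$ let $P(-l,l,0)_{RL}$ be the same link with the two named top arcs reversed and the right strand of the third column still pointing up. (These orientations exist.) For an oriented link $L$ let $V_L(q^2)$ be its Jones polynomial, normalized to be $1$ on the unknot, with $t^{1/2}=-q$, i.e. $q^{-2}V_{L_+}(q^2)-q^{2}V_{L_-}(q^2)=(q^{-1}-q)V_{L_0}(q^2)$, and let $\overline V_L(q^2)=(q+q^{-1})V_L(q^2)$ be the unnormalized Jones polynomial. If $l\ge 3$, then $$\overline V_{P(-l,l,0)_{LR}}(q^2)=(-1)^l q^{2l+1}+\sum_{j=1}^{l-3}(-1)^{j+l+1}q^{2l-2j-1}+(2q+2q^{-1})+\sum_{i=1}^{l-3}(-1)^{i+1}q^{-2i-3}+(-1)^l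 q^{-2l-1},$$ where the sums are empty for $l=3$. If $l=2$, then $$\overline V_{P(-2,2,0)_{LR}}(q^2)=q^5+q^3+2q+2q^{-1}+q^{-3}+q^{-5}.$$ If $l\ge 4$ is even, then $$\overline V_{P(-l,l,0)_{RL}}(q^2)=(-1)^l q^{5l+1}+\sum_{j=1}^{l-3}(-1)^{j+l+1}q^{5l-2j-1}+(2q^{3l+1}+2q^{3l-1})+\sum_{i=1}^{l-3}(-1)^{i+1}q^{3l-2i-3}+(-1)^l q^{l-1},$$ and $\overline V_{P(-2,2,0)_{RL}}(q^2)=q^{11}+q^9+2q^7+2q^5+q^3+q$. -/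

import Mathlib

open LaurentPolynomial

/-- A link diagram given by a planar-diagram code. At the crossing `c` the four ends
`cross c 0, cross c 1, cross c 2, cross c 3` are listed counterclockwise, the under-strand having
the ends `0` and `2` and the over-strand the ends `1` and `3`. Besides crossings there are
two-valent vertices (`Join`), at which two arcs are simply joined. Crossings and joins are the
vertices; a `Slot` is a place at a vertex to which an end of an arc is attached, and every arc has
exactly two ends. -/
structure LinkDiagram where
  Arc : Type
  Crossing : Type
  Join : Type
  [fintypeCrossing : Fintype Crossing]
  [fintypeJoin : Fintype Join]
  cross : Crossing → Fin 4 → Arc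
  join : Join → Fin 2 → Arc
  two_ends : ∀ a : Arc, ∃ s t : (Crossing × Fin 4) ⊕ (Join × Fin 2), s ≠ t ∧
    ∀ u, Sum.elim (fun x => cross x.1 x.2) (fun x => join x.1 x.2) u = a ↔ u = s ∨ u = t

namespace LinkDiagram

attribute [instance] LinkDiagram.fintypeCrossing LinkDiagram.fintypeJoin

/-- The slots at the vertices of a diagram. -/
abbrev Slot (D : LinkDiagram) : Type := (D.Crossing × Fin 4) ⊕ (D.Join × Fin 2)

/-- The arc attached to a slot. -/
def arcAt (D : LinkDiagram) : D.Slot → D.Arc :=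
  Sum.elim (fun x => D.cross x.1 x.2) (fun x => D.join x.1 x.2)

/-- An orientation of the link. `into s = true` means that the strand runs into the vertex at the
slot `s`, and `into s = false` that it leaves the vertex there. -/
structure Orientation (D : LinkDiagram) where
  into : D.Slot → Bool
  cross_opposite : ∀ (c : D.Crossing) (i : Fin 4),
    into (Sum.inl (c, i + 2)) = !into (Sum.inl (c, i))
  join_opposite : ∀ j : D.Join, into (Sum.inr (j, 1)) = !into (Sum.inr (j, 0))
  arc_opposite : ∀ s t : D.Slot, s ≠ t → D.arcAt s = D.arcAt t → into t = !into s

/-- The circles of the smoothing `S`: the pairs of arc ends that are joined. The `0`-smoothing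
(`S c = false`, the `A`-smoothing) of a crossing joins the ends `0, 1` and the ends `2, 3`; the
`1`-smoothing (`S c = true`) joins the ends `0, 3` and the ends `1, 2`. -/
inductive SmoothRel (D : LinkDiagram) (S : D.Crossing → Bool) : D.Arc → D.Arc → Prop
  | zero_left (c : D.Crossing) : S c = false → SmoothRel D S (D.cross c 0) (D.cross c 1)
  | zero_right (c : D.Crossing) : S c = false → SmoothRel D S (D.cross c 2) (D.cross c 3)
  | one_left (c : D.Crossing) : S c = true → SmoothRel D S (D.cross c 0) (D.cross c 3)
  | one_right (c : D.Crossing) : S c = true → SmoothRel D S (D.cross c 1) (D.cross c 2)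
  | join (j : D.Join) : SmoothRel D S (D.join j 0) (D.join j 1)

/-- The number of circles of a smoothing. Every arc has two ends, so the circles are the classes
of the equivalence relation generated by `SmoothRel`. -/
noncomputable def circles (D : LinkDiagram) (S : D.Crossing → Bool) : ℕ :=
  Nat.card (Quot (D.SmoothRel S))

open Classical in
/-- The Kauffman bracket of a non-empty diagram as a state sum in the variable `q`, with
`⟨crossing⟩ = ⟨0-smoothing⟩ - q ⟨1-smoothing⟩`, an additional circle contributing the factor
`q + q⁻¹`, and `⟨one circle⟩ = 1`. (A smoothing of a non-empty diagram has at least one circle, so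
the subtraction below is the usual one.) -/
noncomputable def bracket (D : LinkDiagram) : ℤ[T;T⁻¹] :=
  ∑ S : D.Crossing → Bool,
    (-T 1) ^ (Finset.univ.filter fun c => S c = true).card *
      (T 1 + T (-1)) ^ (D.circles S - 1)

namespace Orientation

variable {D : LinkDiagram}

/-- The sign of a crossing: a crossing is positive if turning the direction of the over-strand
counterclockwise by less than a half turn gives the direction of the under-strand. -/
def IsPositive (o : D.Orientation) (c : D.Crossing) : Prop :=
  o.into (Sum.inl (c, 0)) ≠ o.into (Sum.inl (c, 1))

open Classical in
/-- The number `n₊` of positive crossings. -/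
noncomputable def numPos (o : D.Orientation) : ℕ :=
  (Finset.univ.filter fun c => o.IsPositive c).card

open Classical in
/-- The number `n₋` of negative crossings. -/
noncomputable def numNeg (o : D.Orientation) : ℕ :=
  (Finset.univ.filter fun c => ¬ o.IsPositive c).card

/-- The normalized Jones polynomial `V_L(q²)` of the oriented link with this diagram, as a Laurent
polynomial in `q = T 1`. It satisfies `q⁻² V(L₊) - q² V(L₋) = (q⁻¹ - q) V(L₀)` and is `1` on the
unknot, so it is Jones' `V_L(t)` at `t = q²` with `t^(1/2) = -q`. -/
noncomputable def jones (o : D.Orientation) : ℤ[T;T⁻¹] :=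
  (-1) ^ o.numNeg * T ((o.numPos : ℤ) - 2 * (o.numNeg : ℤ)) * D.bracket

/-- The unnormalized Jones polynomial `(q + q⁻¹) V_L(q²)`. -/
noncomputable def unnormalizedJones (o : D.Orientation) : ℤ[T;T⁻¹] :=
  (T 1 + T (-1)) * o.jones

end Orientation

end LinkDiagram

namespace Pretzel

/-- The corner (is it at the top?, is it on the right?) of a crossing of two vertical strands that
is the end number `i` of the crossing. In a right-handed crossing (`r = true`) the over-strand runs
from the bottom left to the top right corner, in a left-handed crossing from the bottom right to
the top left corner. -/
def corner (r : Bool) (i : Fin 4) : Bool × Bool :=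
  if r then ![(false, true), (true, true), (true, false), (false, false)] i
  else ![(false, false), (false, true), (true, true), (true, false)] i

/-- Points on the strands of the pretzel diagram with columns `p 0, p 1, p 2` (from left to right):
the column `c` has `|p c|` crossings, one above the other, hence the levels `0, …, |p c|` (from the
bottom to the top), and on each level a left (`false`) and a right (`true`) point. -/
abbrev Point (p : Fin 3 → ℤ) : Type := (c : Fin 3) × (Fin ((p c).natAbs + 1) × Bool)

/-- The four ends of a crossing of the column `c`, lying between two consecutive levels; the
column is right-handed if `p c > 0` and left-handed if `p c < 0`. -/
def crossEnd (p : Fin 3 → ℤ) (x : (c : Fin 3) × Fin (p c).natAbs) (i : Fin 4) : Point p :=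
  ⟨x.1, (if (corner (decide (0 < p x.1)) i).1 then x.2.succ else x.2.castSucc,
    (corner (decide (0 < p x.1)) i).2)⟩

/-- The join `(true, c)` joins the top right point of the column `c` to the top left point of the
cyclically next column `c + 1`, and `(false, c)` does so at the bottom. -/
def joinEnd (p : Fin 3 → ℤ) (j : Bool × Fin 3) (i : Fin 2) : Point p :=
  if i = 0 then ⟨j.2, (if j.1 then Fin.last _ else 0, true)⟩
  else ⟨j.2 + 1, (if j.1 then Fin.last _ else 0, false)⟩

theorem exists_corner (r t s : Bool) : ∃ i, ∀ k, corner r k = (t, s) ↔ k = i := by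
  revert r t s; decide

/-- Whether the vertex of a slot lies below the point attached to the slot. -/
def below (p : Fin 3 → ℤ) :
    (((c : Fin 3) × Fin (p c).natAbs) × Fin 4) ⊕ ((Bool × Fin 3) × Fin 2) → Bool :=
  Sum.elim (fun x => (corner (decide (0 < p x.1.1)) x.2).1) (fun x => !x.1.1)

theorem one_end (p : Fin 3 → ℤ) (a : Point p) (v : Bool) :
    ∃ s, ∀ u, (Sum.elim (fun x => crossEnd p x.1 x.2) (fun x => joinEnd p x.1 x.2) u = a ∧
      below p u = v) ↔ u = s := by
  obtain ⟨c, h, e⟩ := a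
  have key : (∃ k : Fin (p c).natAbs, (if v then k.succ else k.castSucc) = h) ∨
      (h = if v then 0 else Fin.last _) := by
    cases v
    · refine Fin.lastCases ?_ (fun k => ?_) h
      · simp
      · exact Or.inl ⟨k, by simp⟩
    · refine Fin.cases ?_ (fun k => ?_) h
      · simp
      · exact Or.inl ⟨k, by simp⟩
  rcases key with ⟨k, rfl⟩ | rfl
  · obtain ⟨i, hi⟩ := exists_corner (decide (0 < p c)) v e
    refine ⟨Sum.inl (⟨c, k⟩, i), ?_⟩
    rintro (⟨⟨d, m⟩, j⟩ | ⟨⟨b, d⟩, j⟩)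
    · by_cases hd : d = c
      · subst hd
        have := hi j
        simp only [Sum.elim_inl, crossEnd, below, Sum.inl.injEq, Prod.mk.injEq, Sigma.mk.injEq,
          heq_eq_eq, true_and, ← this, Prod.ext_iff]
        cases v
        all_goals
          constructor
          · rintro ⟨⟨h1, h2⟩, h3⟩
            simp [h3] at h1
            exact ⟨h1, h3, h2⟩
          · rintro ⟨h1, h3, h2⟩
            subst h1
            simp [h3, h2]
      · simp [crossEnd, hd]
    · simp only [Sum.elim_inr, below, reduceCtorEq, iff_false, not_and]
      intro h1 h2
      fin_cases j
      all_goals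
        simp only [joinEnd, Fin.zero_eta, Fin.mk_one, if_true, Fin.reduceEq, one_ne_zero, if_false]
          at h1
        simp only [Sigma.mk.injEq] at h1
        obtain ⟨h0, h1⟩ := h1
        subst h0
        simp only [heq_eq_eq, Prod.mk.injEq] at h1
        obtain ⟨h1, -⟩ := h1
        subst h2
        cases b <;> simp [Fin.ext_iff] at h1 <;> omega
  · have hc : c - 1 + 1 = c := by revert c; decide
    refine ⟨Sum.inr ((!v, if e then c else c - 1), if e then 0 else 1), ?_⟩
    rintro (⟨⟨d, m⟩, j⟩ | ⟨⟨b, d⟩, j⟩)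
    · simp only [Sum.elim_inl, crossEnd, below, reduceCtorEq, iff_false, not_and]
      intro h1 h2
      simp only [Sigma.mk.injEq] at h1
      obtain ⟨h0, h1⟩ := h1
      subst h0
      simp only [heq_eq_eq, Prod.mk.injEq] at h1
      obtain ⟨h1, -⟩ := h1
      rw [h2] at h1
      cases v <;> simp [Fin.ext_iff] at h1 <;> omega
    · have hb : (!b) = v ↔ b = !v := by cases b <;> cases v <;> simp
      have hd : d + 1 = c ↔ d = c - 1 := by revert c d; decide
      simp only [Sum.elim_inr, below, hb, Sum.inr.injEq, Prod.mk.injEq]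
      fin_cases j
      · simp only [joinEnd, Fin.zero_eta, if_true, Sigma.mk.injEq]
        constructor
        · rintro ⟨⟨h0, h1⟩, h2⟩
          subst h0
          simp only [heq_eq_eq, Prod.mk.injEq] at h1
          simp [h2, ← h1.2]
        · rintro ⟨⟨h1, h2⟩, h3⟩
          cases e
          · simp at h3
          · simp only [if_true] at h2
            subst h2
            subst h1
            cases v <;> simp
      · simp only [joinEnd, Fin.mk_one, one_ne_zero, if_false, Sigma.mk.injEq]
        constructor
        · rintro ⟨⟨h0, h1⟩, h2⟩
          subst h0
          simp only [heq_eq_eq, Prod.mk.injEq] at h1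
          simp [h2, ← h1.2]
        · rintro ⟨⟨h1, h2⟩, h3⟩
          cases e
          · simp only [Bool.false_eq_true, if_false] at h2
            have h2' := hd.2 h2
            subst h2'
            subst h1
            cases v <;> simp
          · simp at h3

theorem two_ends (p : Fin 3 → ℤ) (a : Point p) :
    ∃ s t : (((c : Fin 3) × Fin (p c).natAbs) × Fin 4) ⊕ ((Bool × Fin 3) × Fin 2), s ≠ t ∧
      ∀ u, Sum.elim (fun x => crossEnd p x.1 x.2) (fun x => joinEnd p x.1 x.2) u = a ↔
        u = s ∨ u = t := by
  obtain ⟨s, hs⟩ := one_end p a true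
  obtain ⟨t, ht⟩ := one_end p a false
  refine ⟨s, t, ?_, fun u => ?_⟩
  · rintro rfl
    have h1 := ((hs s).2 rfl).2
    have h2 := ((ht s).2 rfl).2
    simp [h1] at h2
  · rw [← hs, ← ht]
    cases below p u <;> simp

end Pretzel

/-- The standard diagram of the pretzel link `P(l, m, n)`: three columns of `|l|`, `|m|`, `|n|`
crossings, a column being right-handed if the integer is positive and left-handed if it is
negative (and two vertical strands without a crossing if it is zero). -/
def pretzel (l m n : ℤ) : LinkDiagram where
  Arc := Pretzel.Point ![l, m, n]
  Crossing := (c : Fin 3) × Fin ((![l, m, n] : Fin 3 → ℤ) c).natAbs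
  Join := Bool × Fin 3
  cross := Pretzel.crossEnd ![l, m, n]
  join := Pretzel.joinEnd ![l, m, n]
  two_ends := Pretzel.two_ends ![l, m, n]

/-- The orientation pattern of an oriented three-strand pretzel diagram: the right strand of the
third column runs upwards at its top end; the top arc from the first to the second column is
directed to the right if `r₁ = true` and to the left if `r₁ = false`; the top arc from the second to
the third column is directed to the right if `r₂ = true` and to the left if `r₂ = false`. -/
def HasPattern {l m n : ℤ} (o : (pretzel l m n).Orientation) (r₁ r₂ : Bool) : Prop :=
  o.into (Sum.inr ((true, 2), 0)) = true ∧
  o.into (Sum.inr ((true, 0), 0)) = r₁ ∧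
  o.into (Sum.inr ((true, 1), 0)) = r₂

/-- The orientation pattern `LR`: the first and the second column consist of parallel strands, the
third of antiparallel strands. -/
def IsLR {l m n : ℤ} (o : (pretzel l m n).Orientation) : Prop := HasPattern o false true

/-- The orientation pattern `RL`: the second and the third column consist of parallel strands, the
first of antiparallel strands. -/
def IsRL {l m n : ℤ} (o : (pretzel l m n).Orientation) : Prop := HasPattern o true false

/-! With no crossing in its third column, `P(-l,l,0)` is a connected sum of two mirror torus links
on two strands, so its bracket should factor over the first two columns. In a smoothing let `h` be
the number of crossings of a column smoothed to a cup and a cap. The circle count is 1 plus one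
contribution from each of the first two columns: 1 if `h = 0`, and `h - 1` otherwise
(`circles_pretzel`). Hence the state sum is a product of column sums (`bracket_pretzel`).

Put `δ = q + q⁻¹` and `w = δ² - 1 = q² + 1 + q⁻²`. By the binomial theorem (`mul_columnSum`), `δ`
times the two column sums are `q⁻ˡ + (-1)ˡ qˡ w` and `(-1)ˡ q²ˡ + w`. For `LR` there are `l`
crossings of each sign, and `δ` times the unnormalized polynomial is `1 + (-1)ˡ (q²ˡ + q⁻²ˡ) w +
w²`. Since `δ` is not a zero divisor, the claimed formula is checked after multiplication by `δ`,
where its alternating geometric sums telescope. For `RL` all `2l` crossings are positive, which only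
multiplies the answer by `q³ˡ`. -/

namespace Pretzel

/-! ### Counting the circles of a smoothing. -/

section Circles

variable {p : Fin 3 → ℤ}

/-- The `k`-th crossing of the column `c` is smoothed to a cup and a cap (and not to two vertical
strands). -/
def IsHorizontal (S : ((c : Fin 3) × Fin (p c).natAbs) → Bool) (c : Fin 3) (k : ℕ) : Prop :=
  -- The ends 0 and 1 are the two right corners of a right-handed crossing but the two bottom
  -- corners of a left-handed one, so the horizontal smoothing is the 1-smoothing in the first case
  -- and the 0-smoothing in the second.
  ∃ hk : k < (p c).natAbs, S ⟨c, ⟨k, hk⟩⟩ = decide (0 < p c)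

instance (S : ((c : Fin 3) × Fin (p c).natAbs) → Bool) (c : Fin 3) :
    DecidablePred (IsHorizontal S c) :=
  fun _ => inferInstanceAs (Decidable (∃ _, _))

/-- The number of horizontally smoothed crossings of the column `c` below the level `h`. -/
def depth (S : ((c : Fin 3) × Fin (p c).natAbs) → Bool) (c : Fin 3) (h : ℕ) : ℕ :=
  Nat.count (IsHorizontal S c) h

/-- The number of horizontally smoothed crossings of the column `c`. -/
def numHorizontal (S : ((c : Fin 3) × Fin (p c).natAbs) → Bool) (c : Fin 3) : ℕ :=
  depth S c (p c).natAbs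

/-- A function on the points that is constant on the circles of the smoothing `S`. -/
structure IsInvariant {α : Type*} (S : ((c : Fin 3) × Fin (p c).natAbs) → Bool)
    (f : Point p → α) : Prop where
  vertical : ∀ c (k : Fin (p c).natAbs) e, ¬ IsHorizontal S c k →
    f ⟨c, (k.castSucc, e)⟩ = f ⟨c, (k.succ, e)⟩
  cup : ∀ c (k : Fin (p c).natAbs), IsHorizontal S c k →
    f ⟨c, (k.succ, false)⟩ = f ⟨c, (k.succ, true)⟩
  cap : ∀ c (k : Fin (p c).natAbs), IsHorizontal S c k →
    f ⟨c, (k.castSucc, false)⟩ = f ⟨c, (k.castSucc, true)⟩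
  top : ∀ c, f ⟨c, (Fin.last _, true)⟩ = f ⟨c + 1, (Fin.last _, false)⟩
  bottom : ∀ c, f ⟨c, (0, true)⟩ = f ⟨c + 1, (0, false)⟩

theorem isHorizontal_coe (S : ((c : Fin 3) × Fin (p c).natAbs) → Bool) (c : Fin 3)
    (k : Fin (p c).natAbs) : IsHorizontal S c k ↔ S ⟨c, k⟩ = decide (0 < p c) := by
  simp [IsHorizontal]

/-- The quotient map is itself invariant. Applied to it, every identity proved for invariant
functions says that two points lie on one circle. -/
theorem isInvariant_mk {l m n : ℤ}
    (S : ((c : Fin 3) × Fin ((![l, m, n] : Fin 3 → ℤ) c).natAbs) → Bool) :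
    IsInvariant (p := ![l, m, n]) S
      (fun a => Quot.mk ((pretzel l m n).SmoothRel S) a) := by
  have h0l := fun c (hc : S c = false) =>
    Quot.sound (LinkDiagram.SmoothRel.zero_left (D := pretzel l m n) c hc)
  have h0r := fun c (hc : S c = false) =>
    Quot.sound (LinkDiagram.SmoothRel.zero_right (D := pretzel l m n) c hc)
  have h1l := fun c (hc : S c = true) =>
    Quot.sound (LinkDiagram.SmoothRel.one_left (D := pretzel l m n) c hc)
  have h1r := fun c (hc : S c = true) =>
    Quot.sound (LinkDiagram.SmoothRel.one_right (D := pretzel l m n) c hc)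
  have hj := fun j => Quot.sound (LinkDiagram.SmoothRel.join (D := pretzel l m n) (S := S) j)
  refine ⟨fun c k e hk => ?_, fun c k hk => ?_, fun c k hk => ?_, fun c => hj (true, c),
    fun c => hj (false, c)⟩
  all_goals
    rw [isHorizontal_coe] at hk
    specialize h0l ⟨c, k⟩
    specialize h0r ⟨c, k⟩
    specialize h1l ⟨c, k⟩
    specialize h1r ⟨c, k⟩
    by_cases hp : 0 < (![l, m, n] : Fin 3 → ℤ) c <;>
      simp [hp, pretzel, crossEnd, corner] at hk h0l h0r h1l h1r
  · cases e
    · exact (h0r hk).symm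
    · exact h0l hk
  · cases e
    · exact h1l hk
    · exact h1r hk
  · exact (h1r hk).symm
  · exact (h0r hk).symm
  · exact (h1l hk).symm
  · exact h0l hk

theorem IsInvariant.of_smoothRel {α : Type*} {l m n : ℤ}
    {S : ((c : Fin 3) × Fin ((![l, m, n] : Fin 3 → ℤ) c).natAbs) → Bool} {f : (pretzel l m n).Arc → α} (hf : IsInvariant (p := ![l, m, n]) S f)
    {a b : (pretzel l m n).Arc} (h : (pretzel l m n).SmoothRel S a b) : f a = f b := by
  obtain ⟨hv, hcup, hcap, ht, hb⟩ := hf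
  simp only [isHorizontal_coe] at hv hcup hcap
  induction h with
  | join j =>
    obtain ⟨b, c⟩ := j
    cases b
    · exact hb c
    · exact ht c
  | _ c hc =>
    obtain ⟨c, k⟩ := c
    specialize hv c k
    specialize hcup c k
    specialize hcap c k
    by_cases hp : 0 < (![l, m, n] : Fin 3 → ℤ) c <;>
      simp [hp, pretzel, crossEnd, corner, hc] at hv hcup hcap ⊢ <;> grind

section Invariant

variable {α : Type*} {S : ((c : Fin 3) × Fin (p c).natAbs) → Bool} {f : Point p → α}

theorem depth_succ (c : Fin 3) (h : ℕ) :
    depth S c (h + 1) = depth S c h + if IsHorizontal S c h then 1 else 0 :=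
  Nat.count_succ _ _

theorem depth_zero (c : Fin 3) : depth S c 0 = 0 := Nat.count_zero _

theorem depth_mono (c : Fin 3) : Monotone (depth S c) := Nat.count_monotone _

theorem depth_le (c : Fin 3) (h : Fin ((p c).natAbs + 1)) : depth S c h ≤ numHorizontal S c :=
  depth_mono c (by have := h.2; omega)

theorem exists_depth_eq (c : Fin 3) {d : ℕ} (hd : d ≤ numHorizontal S c) :
    ∃ h : Fin ((p c).natAbs + 1), depth S c h = d := by
  suffices ∀ n, d ≤ depth S c n → ∃ h ≤ n, depth S c h = d by
    obtain ⟨h, hh, e⟩ := this _ hd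
    exact ⟨⟨h, by omega⟩, e⟩
  intro n
  induction n with
  | zero => intro h; exact ⟨0, le_rfl, by rw [depth_zero] at *; omega⟩
  | succ n ih =>
    intro h
    by_cases h' : d ≤ depth S c n
    · obtain ⟨k, hk, e⟩ := ih h'
      exact ⟨k, by omega, e⟩
    · refine ⟨n + 1, le_rfl, ?_⟩
      rw [depth_succ] at *
      split_ifs at * <;> omega

/-- Between two levels of equal depth every crossing is smoothed vertically, so each side is an
uninterrupted strand. -/
theorem IsInvariant.eq_of_depth_eq (hf : IsInvariant S f) (c : Fin 3)
    {h h' : Fin ((p c).natAbs + 1)} (e : Bool) (heq : depth S c h = depth S c h') :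
    f ⟨c, (h, e)⟩ = f ⟨c, (h', e)⟩ := by
  wlog hle : h ≤ h' generalizing h h'
  · exact (this heq.symm (by omega)).symm
  induction h' using Fin.induction with
  | zero =>
    obtain rfl : h = 0 := by simpa using hle
    rfl
  | succ k ih =>
    rcases eq_or_lt_of_le hle with rfl | hlt
    · rfl
    have hk : h ≤ k.castSucc := by simpa [Fin.le_def, Fin.lt_def, Nat.lt_succ_iff] using hlt
    have h1 := depth_mono (S := S) c (Fin.le_def.1 hk)
    have h2 := depth_succ (S := S) c k
    simp only [Fin.val_castSucc, Fin.val_succ] at *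
    have hv : ¬ IsHorizontal S c k := by
      intro hh
      simp only [hh, if_true] at h2
      omega
    simp only [hv, if_false] at h2
    rw [ih (by omega) hk, hf.vertical c k e hv]

/-- Descending along vertical smoothings from a level of positive depth leads to a horizontal one,
whose upper arc connects the two sides. -/
theorem IsInvariant.eq_of_depth_pos (hf : IsInvariant S f) (c : Fin 3)
    (h : Fin ((p c).natAbs + 1)) (hpos : 0 < depth S c h) :
    f ⟨c, (h, false)⟩ = f ⟨c, (h, true)⟩ := by
  induction h using Fin.induction with
  | zero => simp [depth_zero] at hpos
  | succ k ih =>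
    by_cases hk : IsHorizontal S c k
    · exact hf.cup c k hk
    · simp only [Fin.val_succ, depth_succ, hk, if_false] at hpos
      rw [← hf.vertical c k _ hk, ← hf.vertical c k _ hk]
      exact ih hpos

theorem IsInvariant.eq_of_depth_lt (hf : IsInvariant S f) (c : Fin 3)
    (h : Fin ((p c).natAbs + 1)) (hlt : depth S c h < numHorizontal S c) :
    f ⟨c, (h, false)⟩ = f ⟨c, (h, true)⟩ := by
  induction h using Fin.reverseInduction with
  | last => simp [numHorizontal] at hlt
  | cast k ih =>
    by_cases hk : IsHorizontal S c k
    · exact hf.cap c k hk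
    · rw [hf.vertical c k _ hk, hf.vertical c k _ hk]
      refine ih ?_
      simpa [depth_succ, hk] using hlt

theorem IsInvariant.left_eq_right (hf : IsInvariant S f) (c : Fin 3)
    (h : Fin ((p c).natAbs + 1)) (hpos : 0 < numHorizontal S c) :
    f ⟨c, (h, false)⟩ = f ⟨c, (h, true)⟩ := by
  rcases (Nat.zero_le (depth S c h)).eq_or_lt with h0 | h0
  · exact hf.eq_of_depth_lt c h (h0 ▸ hpos)
  · exact hf.eq_of_depth_pos c h h0

theorem IsInvariant.bottom_eq_top_of_eq_zero (hf : IsInvariant S f) (c : Fin 3) (e : Bool)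
    (h0 : numHorizontal S c = 0) : f ⟨c, (0, e)⟩ = f ⟨c, (Fin.last _, e)⟩ :=
  hf.eq_of_depth_eq c e (by simpa [depth_zero, numHorizontal] using h0.symm)

theorem numHorizontal_two (h2 : p 2 = 0) : numHorizontal S 2 = 0 := by
  simp [numHorizontal, h2, depth_zero]

/-- The top and bottom arcs between two neighbouring columns lie on one circle. The only case
without a straight strand next to them is the gap between columns 0 and 1 when both have horizontal
smoothings; the path then goes around through the third column. -/
theorem IsInvariant.bottom_eq_top (hf : IsInvariant S f) (h2 : p 2 = 0) (c : Fin 3) :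
    f ⟨c, (0, true)⟩ = f ⟨c, (Fin.last _, true)⟩ := by
  have key := hf.bottom_eq_top_of_eq_zero
  have t := hf.top
  have b := hf.bottom
  have k2 := fun e => key 2 e (numHorizontal_two h2)
  fin_cases c
  · by_cases h0 : numHorizontal S 0 = 0
    · exact key 0 true h0
    by_cases h1 : numHorizontal S 1 = 0
    · exact (b 0).trans ((key 1 false h1).trans (t 0).symm)
    have l0 := fun h => hf.left_eq_right 0 h (by omega)
    exact (l0 _).symm.trans ((b 2).symm.trans ((k2 true).trans ((t 2).trans (l0 _))))
  · exact (b 1).trans ((k2 false).trans (t 1).symm)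
  · exact k2 true

/-- The outer circle that contains the arcs from the column `i` to the column `i + 1`. -/
def outerCircle (S : ((c : Fin 3) × Fin (p c).natAbs) → Bool) (i : Fin 3) : Fin 3 :=
  -- A horizontal smoothing in a column merges the circles of the gaps on its two sides. Gap 0
  -- touches both columns that can do so and serves as the representative.
  if i = 1 ∧ 0 < numHorizontal S 1 ∨ i = 2 ∧ 0 < numHorizontal S 0 then 0 else i

/-- The circle of the smoothing `S` that contains a point. -/
def circleOf (S : ((c : Fin 3) × Fin (p c).natAbs) → Bool) (a : Point p) :
    Fin 3 ⊕ ((_ : Fin 3) × ℕ) :=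
  -- Depth strictly between the extremes means lying between two consecutive horizontal smoothings,
  -- on a small circle determined by column and depth. All other points are joined to the top or
  -- bottom arc on their side.
  if 0 < depth S a.1 a.2.1 ∧ depth S a.1 a.2.1 < numHorizontal S a.1 then
    Sum.inr ⟨a.1, depth S a.1 a.2.1⟩
  else Sum.inl (outerCircle S (if a.2.2 then a.1 else a.1 - 1))

theorem IsInvariant.eq_outerCircle (hf : IsInvariant S f) (i : Fin 3) :
    f ⟨i, (Fin.last _, true)⟩ = f ⟨outerCircle S i, (Fin.last _, true)⟩ := by
  by_cases h : i = 1 ∧ 0 < numHorizontal S 1 ∨ i = 2 ∧ 0 < numHorizontal S 0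
  · rw [show outerCircle S i = 0 from if_pos h]
    rcases h with ⟨rfl, h⟩ | ⟨rfl, h⟩
    · exact (hf.left_eq_right 1 _ h).symm.trans (hf.top 0).symm
    · exact (hf.top 2).trans (hf.left_eq_right 0 _ h)
  · rw [show outerCircle S i = i from if_neg h]

theorem IsInvariant.eq_top (hf : IsInvariant S f) (h2 : p 2 = 0) (a : Point p)
    (ha : ¬ (0 < depth S a.1 a.2.1 ∧ depth S a.1 a.2.1 < numHorizontal S a.1)) :
    f a = f ⟨outerCircle S (if a.2.2 then a.1 else a.1 - 1), (Fin.last _, true)⟩ := by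
  obtain ⟨c, h, e⟩ := a
  rw [← hf.eq_outerCircle]
  have hle := depth_le (S := S) c h
  have hc : c - 1 + 1 = c := sub_add_cancel c 1
  rcases Nat.eq_zero_or_pos (depth S c h) with h0 | h0
  · rw [hf.eq_of_depth_eq c e (h' := 0) (by simp [h0, depth_zero])]
    cases e
    · have := hf.bottom (c - 1)
      rw [hc] at this
      simp [← this, hf.bottom_eq_top h2]
    · simp [hf.bottom_eq_top h2]
  · simp only [not_and, not_lt, h0, true_implies] at ha
    rw [hf.eq_of_depth_eq c e (h' := Fin.last _) (le_antisymm hle ha)]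
    cases e
    · have := hf.top (c - 1)
      rw [hc] at this
      simp [← this]
    · simp

theorem IsInvariant.eq_of_circleOf_eq (hf : IsInvariant S f) (h2 : p 2 = 0) {a b : Point p}
    (hab : circleOf S a = circleOf S b) : f a = f b := by
  unfold circleOf at hab
  by_cases ha : 0 < depth S a.1 a.2.1 ∧ depth S a.1 a.2.1 < numHorizontal S a.1 <;>
  by_cases hb : 0 < depth S b.1 b.2.1 ∧ depth S b.1 b.2.1 < numHorizontal S b.1
  · rw [if_pos ha, if_pos hb] at hab
    obtain ⟨c, h, e⟩ := a
    obtain ⟨c', h', e'⟩ := b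
    simp only [Sum.inr.injEq, Sigma.mk.injEq, heq_eq_eq] at hab
    obtain ⟨rfl, hd⟩ := hab
    rw [hf.eq_of_depth_eq c e hd]
    have := hf.eq_of_depth_pos c h' hb.1
    cases e <;> cases e' <;> simp [this]
  · simp [if_pos ha, if_neg hb] at hab
  · simp [if_neg ha, if_pos hb] at hab
  · rw [if_neg ha, if_neg hb] at hab
    rw [hf.eq_top h2 a ha, hf.eq_top h2 b hb, Sum.inl.inj hab]

theorem outerCircle_sub_one (h2 : p 2 = 0) (c : Fin 3) (hc : 0 < numHorizontal S c) :
    outerCircle S (c - 1) = outerCircle S c := by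
  have := numHorizontal_two (S := S) h2
  fin_cases c
  · change outerCircle S 2 = outerCircle S 0
    simpa [outerCircle] using fun h : numHorizontal S 0 = 0 => absurd h hc.ne'
  · change outerCircle S 0 = outerCircle S 1
    simpa [outerCircle] using hc.ne'
  · simp [this] at hc

theorem circleOf_left (h2 : p 2 = 0) (c : Fin 3) (h : Fin ((p c).natAbs + 1))
    (hc : 0 < numHorizontal S c) :
    circleOf S ⟨c, (h, false)⟩ = circleOf S ⟨c, (h, true)⟩ := by
  simp [circleOf, outerCircle_sub_one h2 c hc]

theorem IsHorizontal.numHorizontal_pos {c : Fin 3} {k : ℕ} (hk : IsHorizontal S c k) :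
    0 < numHorizontal S c := by
  have h1 := depth_succ (S := S) c k
  have h2 := depth_mono (S := S) c (Nat.succ_le_of_lt hk.1)
  simp only [hk, if_true, Nat.succ_eq_add_one] at h1 h2
  unfold numHorizontal
  omega

theorem isInvariant_circleOf (h2 : p 2 = 0)
    (S : ((c : Fin 3) × Fin (p c).natAbs) → Bool) : IsInvariant S (circleOf S) where
  vertical c k e hk := by simp [circleOf, depth_succ, hk]
  cup c k hk := circleOf_left h2 c _ hk.numHorizontal_pos
  cap c k hk := circleOf_left h2 c _ hk.numHorizontal_pos
  top c := by simp [circleOf, numHorizontal]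
  bottom c := by simp [circleOf, depth_zero]

/-- The labels attained are the representatives of the outer circles and, for each column, one inner
circle per pair of consecutive horizontal smoothings. -/
theorem range_circleOf (S : ((c : Fin 3) × Fin (p c).natAbs) → Bool) :
    Set.range (circleOf S) = ((Finset.univ.filter fun i => outerCircle S i = i).disjSum
      (Finset.univ.sigma fun c => Finset.Ioo 0 (numHorizontal S c)) :
      Finset (Fin 3 ⊕ ((_ : Fin 3) × ℕ))) := by
  have hidem : ∀ i, outerCircle S (outerCircle S i) = outerCircle S i := by
    intro i
    unfold outerCircle
    split_ifs <;> simp_all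
  ext x
  simp only [Set.mem_range, Finset.mem_coe]
  constructor
  · rintro ⟨a, rfl⟩
    unfold circleOf
    split_ifs <;> simp_all
  · rcases x with i | ⟨c, d⟩
    · simp only [Finset.inl_mem_disjSum, Finset.mem_filter, Finset.mem_univ, true_and]
      intro hi
      exact ⟨⟨i, (0, true)⟩, by simp [circleOf, depth_zero, hi]⟩
    · simp only [Finset.inr_mem_disjSum, Finset.mem_sigma, Finset.mem_univ, true_and,
        Finset.mem_Ioo]
      intro hd
      obtain ⟨h, rfl⟩ := exists_depth_eq c hd.2.le
      exact ⟨⟨c, (h, true)⟩, by simp [circleOf, hd]⟩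

theorem card_filter_outerCircle (S : ((c : Fin 3) × Fin (p c).natAbs) → Bool) :
    (Finset.univ.filter fun i => outerCircle S i = i).card =
      1 + (if numHorizontal S 0 = 0 then 1 else 0) + if numHorizontal S 1 = 0 then 1 else 0 := by
  rw [Finset.card_filter, Fin.sum_univ_three]
  by_cases h0 : numHorizontal S 0 = 0 <;> by_cases h1 : numHorizontal S 1 = 0 <;>
    simp [outerCircle, h0, h1, Nat.pos_iff_ne_zero]

end Invariant
theorem circles_pretzel {l m : ℤ}
    (S : ((c : Fin 3) × Fin ((![l, m, 0] : Fin 3 → ℤ) c).natAbs) → Bool) :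
    (pretzel l m 0).circles S =
      1 + (if numHorizontal (p := ![l, m, 0]) S 0 = 0 then 1
        else numHorizontal (p := ![l, m, 0]) S 0 - 1)
      + (if numHorizontal (p := ![l, m, 0]) S 1 = 0 then 1
        else numHorizontal (p := ![l, m, 0]) S 1 - 1) := by
  have h2 : (![l, m, 0] : Fin 3 → ℤ) 2 = 0 := rfl
  let g : Quot ((pretzel l m 0).SmoothRel S) → Fin 3 ⊕ ((_ : Fin 3) × ℕ) :=
    Quot.lift (circleOf (p := ![l, m, 0]) S)
      fun _ _ h => (isInvariant_circleOf h2 S).of_smoothRel h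
  -- `circleOf` is a complete invariant: it is constant on circles and separates them, so circles
  -- are counted by its range.
  have hg : Function.Injective g := by
    rintro ⟨a⟩ ⟨b⟩ hab
    exact (isInvariant_mk (l := l) (m := m) (n := 0) S).eq_of_circleOf_eq h2 hab
  have hr : Set.range g = Set.range (circleOf (p := ![l, m, 0]) S) :=
    Set.range_quot_lift _
  unfold LinkDiagram.circles
  rw [Nat.card_congr (Equiv.ofInjective g hg), hr, range_circleOf, Nat.card_coe_set_eq,
    Set.ncard_coe_finset, Finset.card_disjSum, card_filter_outerCircle, Finset.card_sigma,
    Fin.sum_univ_three, numHorizontal_two h2]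
  simp only [Nat.card_Ioo]
  split_ifs <;> omega

end Circles
end Pretzel

/-- Leaves the `Fintype` instance free, so that the classical instance in `bracket` can be exchanged
for the one on a concrete crossing type. -/
theorem LinkDiagram.bracket_eq_sum (D : LinkDiagram) (inst : Fintype (D.Crossing → Bool)) :
    D.bracket = ∑ S : D.Crossing → Bool, (-T 1) ^ (∑ c, if S c = true then 1 else 0) *
      (T 1 + T (-1)) ^ (D.circles S - 1) := by
  simp only [LinkDiagram.bracket, Finset.card_filter]
  congr!

namespace Pretzel

/-! ### Factorization of the bracket over the columns. -/

section Bracket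

theorem sum_sigma_prod {R : Type*} [CommSemiring R] {ι : Type*} [Fintype ι] [DecidableEq ι]
    {κ : ι → Type*} [∀ i, Fintype (κ i)] [∀ i, DecidableEq (κ i)]
    (F : (i : ι) → (κ i → Bool) → R) :
    ∑ S : ((i : ι) × κ i) → Bool, ∏ i, F i (fun k => S ⟨i, k⟩) = ∏ i, ∑ s, F i s := by
  rw [Finset.prod_univ_sum, Fintype.piFinset_univ]
  exact Fintype.sum_equiv (Equiv.piCurry fun _ _ => Bool) _ _ fun _ => rfl

/-- The contribution of a column of `n` crossings (right-handed if `r = true`) to the state sum: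
`x` is the weight of a `1`-smoothing and `δ` the weight of a circle. -/
def columnSum {R : Type*} [CommRing R] (x δ : R) (r : Bool) (n : ℕ) : R :=
  ∑ s : Fin n → Bool, x ^ (∑ k, if s k = true then 1 else 0) *
    δ ^ (if (∑ k, if s k = r then 1 else 0) = 0 then 1 else (∑ k, if s k = r then 1 else 0) - 1)

/-- After multiplication by `δ` a state with `h` horizontal crossings has circle weight `δ ^ h`,
which is multiplicative over crossings. The only exception is `h = 0`, where the weight is `δ ^ 2`
instead of 1; the second term corrects for this. -/
theorem mul_columnSum {R : Type*} [CommRing R] (x δ : R) (r : Bool) (n : ℕ) :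
    δ * columnSum x δ r n =
      (if r then 1 + x * δ else δ + x) ^ n + (δ ^ 2 - 1) * (if r then 1 else x) ^ n := by
  have hsum : (if r then 1 + x * δ else δ + x) =
      ∑ b : Bool, (if b = true then x else 1) * (if b = r then δ else 1) := by
    cases r <;> simp <;> ring
  -- The correction comes from the single all-vertical state, written as a sum over all states so
  -- that the comparison is termwise.
  have hone : (if r then (1 : R) else x) ^ n =
      ∑ s : Fin n → Bool, if s = fun _ => !r then x ^ (∑ k, if s k = true then 1 else 0) else 0 := by
    rw [Finset.sum_ite_eq']
    cases r <;> simp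
  rw [hsum, Fintype.sum_pow, hone, Finset.mul_sum, columnSum, Finset.mul_sum,
    ← Finset.sum_add_distrib]
  refine Finset.sum_congr rfl fun s _ => ?_
  have h0 : (∑ k, if s k = r then 1 else 0) = 0 ↔ s = fun _ => !r := by
    rw [Finset.sum_eq_zero_iff, funext_iff]
    refine forall_congr' fun k => ?_
    cases s k <;> cases r <;> simp
  have hp : ∀ (b : Bool) (y : R), ∏ k, (if s k = b then y else 1) =
      y ^ (∑ k, if s k = b then 1 else 0) := by
    intro b y
    rw [← Finset.prod_pow_eq_pow_sum]
    refine Finset.prod_congr rfl fun k _ => ?_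
    split_ifs <;> simp
  rw [Finset.prod_mul_distrib, hp, hp]
  by_cases h : (∑ k, if s k = r then 1 else 0) = 0
  · rw [if_pos h, if_pos (h0.1 h), h]
    ring
  · rw [if_neg h, if_neg (fun h' => h (h0.2 h'))]
    obtain ⟨j, hj⟩ := Nat.exists_eq_succ_of_ne_zero h
    rw [hj, Nat.succ_eq_add_one, Nat.add_sub_cancel]
    ring

theorem numHorizontal_eq_sum {p : Fin 3 → ℤ} (S : ((c : Fin 3) × Fin (p c).natAbs) → Bool)
    (c : Fin 3) :
    numHorizontal S c = ∑ k, if S ⟨c, k⟩ = decide (0 < p c) then 1 else 0 := by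
  rw [numHorizontal, depth, Nat.count_eq_card_filter_range, Finset.card_filter,
    ← Fin.sum_univ_eq_sum_range]
  simp [isHorizontal_coe]

theorem bracket_summand {l m : ℤ}
    (S : ((c : Fin 3) × Fin ((![l, m, 0] : Fin 3 → ℤ) c).natAbs) → Bool) (x δ : ℤ[T;T⁻¹]) :
    x ^ (∑ c, if S c = true then 1 else 0) * δ ^ ((pretzel l m 0).circles S - 1) =
      ∏ c, (x ^ (∑ k, if S ⟨c, k⟩ = true then 1 else 0) *
        if c = 2 then 1 else δ ^ (if (∑ k, if S ⟨c, k⟩ = decide (0 < (![l, m, 0] : Fin 3 → ℤ) c)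
          then 1 else 0) = 0 then 1
          else (∑ k, if S ⟨c, k⟩ = decide (0 < (![l, m, 0] : Fin 3 → ℤ) c) then 1 else 0) - 1)) := by
  rw [circles_pretzel S, numHorizontal_eq_sum, numHorizontal_eq_sum, add_assoc,
    Nat.add_sub_cancel_left, pow_add, Finset.prod_mul_distrib, Finset.prod_pow_eq_pow_sum,
    Fintype.sum_sigma, Fin.prod_univ_three (fun c => if c = 2 then 1 else _)]
  rw [if_neg (by decide : (0 : Fin 3) ≠ 2), if_neg (by decide : (1 : Fin 3) ≠ 2), if_pos rfl,
    mul_one]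

theorem bracket_pretzel (l m : ℤ) :
    (pretzel l m 0).bracket =
      columnSum (-T 1) (T 1 + T (-1)) (decide (0 < l)) l.natAbs *
        columnSum (-T 1) (T 1 + T (-1)) (decide (0 < m)) m.natAbs := by
  have key : (pretzel l m 0).bracket =
      ∑ S : ((c : Fin 3) × Fin ((![l, m, 0] : Fin 3 → ℤ) c).natAbs) → Bool,
        (-T 1) ^ (∑ c, if S c = true then 1 else 0) *
          (T 1 + T (-1)) ^ ((pretzel l m 0).circles S - 1) := by
    exact LinkDiagram.bracket_eq_sum _ _
  rw [key, Fintype.sum_congr _ _ fun S => bracket_summand S (-T 1) (T 1 + T (-1)),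
    sum_sigma_prod fun (c : Fin 3) (s : Fin ((![l, m, 0] : Fin 3 → ℤ) c).natAbs → Bool) =>
      (-T 1 : ℤ[T;T⁻¹]) ^ (∑ k, if s k = true then 1 else 0) *
        if c = 2 then 1 else (T 1 + T (-1)) ^ (if (∑ k, if s k =
          decide (0 < (![l, m, 0] : Fin 3 → ℤ) c) then 1 else 0) = 0 then 1
          else (∑ k, if s k = decide (0 < (![l, m, 0] : Fin 3 → ℤ) c) then 1 else 0) - 1),
    Fin.prod_univ_three]
  have h0 : ((0 : Fin 3) = 2) = False := by simp
  have h1 : ((1 : Fin 3) = 2) = False := by simp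
  simp only [h0, h1, if_true, if_false]
  -- The third column has a single, empty state, so its factor is 1.
  refine (congrArg _ ?_).trans (mul_one _)
  change ∑ s : Fin 0 → Bool, (-T 1 : ℤ[T;T⁻¹]) ^ (∑ k, if s k = true then 1 else 0) * 1 = 1
  simp

end Bracket
end Pretzel

namespace Pretzel

/-! ### Orientations and signs of crossings. -/

section Orientation

/-- The orientation of a pretzel diagram with given directions of the strands at all points. -/
def orientationOfUp {l m n : ℤ} (up : Point ![l, m, n] → Bool)
    (hcross : ∀ c k e, up ⟨c, (Fin.succ k, e)⟩ = up ⟨c, (k.castSucc, !e)⟩)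
    (htop : ∀ c, up ⟨c + 1, (Fin.last _, false)⟩ = !up ⟨c, (Fin.last _, true)⟩)
    (hbottom : ∀ c, up ⟨c + 1, (0, false)⟩ = !up ⟨c, (0, true)⟩) :
    (pretzel l m n).Orientation where
  into s := xor (up ((pretzel l m n).arcAt s)) (below ![l, m, n] s)
  cross_opposite := by
    rintro ⟨c, k⟩ i
    have h := hcross c k
    by_cases hp : 0 < (![l, m, n] : Fin 3 → ℤ) c <;> fin_cases i <;>
      simp [LinkDiagram.arcAt, pretzel, crossEnd, corner, below, hp, h]
  join_opposite := by
    rintro ⟨b, c⟩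
    cases b
    · simp [LinkDiagram.arcAt, pretzel, joinEnd, below, hbottom]
    · simp [LinkDiagram.arcAt, pretzel, joinEnd, below, htop]
  arc_opposite s t hst h := by
    have hb : below ![l, m, n] t = !below ![l, m, n] s := by
      by_contra hb
      -- Each point has only one slot on a given side, so two distinct slots of an arc lie on
      -- opposite sides of it.
      obtain ⟨r, hr⟩ := one_end ![l, m, n] ((pretzel l m n).arcAt s) (below ![l, m, n] s)
      exact hst (((hr s).1 ⟨rfl, rfl⟩).trans ((hr t).1 ⟨h.symm, by simpa using hb⟩).symm)
    rw [← h, hb]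
    simp

variable {l m n : ℤ} (o : (pretzel l m n).Orientation)

/-- Whether the strand through a point runs upwards. -/
noncomputable def up (a : Point ![l, m, n]) : Bool :=
  !o.into (one_end ![l, m, n] a true).choose

theorem into_eq (s : (pretzel l m n).Slot) :
    o.into s = xor (up o ((pretzel l m n).arcAt s)) (below ![l, m, n] s) := by
  have hr := (one_end ![l, m, n] ((pretzel l m n).arcAt s) true).choose_spec
  unfold up
  set r := (one_end ![l, m, n] ((pretzel l m n).arcAt s) true).choose with hrdef
  have h0 := (hr r).2 rfl
  cases hb : below ![l, m, n] s
  · have hne : r ≠ s := by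
      intro h
      rw [h, hb] at h0
      exact Bool.false_ne_true h0.2
    rw [o.arc_opposite r s hne h0.1]
    simp
  · rw [show s = r from (hr s).1 ⟨rfl, hb⟩]
    simp

theorem up_succ (c : Fin 3) (k : Fin ((![l, m, n] : Fin 3 → ℤ) c).natAbs) (e : Bool) :
    up o ⟨c, (k.succ, e)⟩ = up o ⟨c, (k.castSucc, !e)⟩ := by
  have h0 := o.cross_opposite ⟨c, k⟩ 0
  have h1 := o.cross_opposite ⟨c, k⟩ 1
  rw [into_eq, into_eq] at h0 h1
  by_cases hp : 0 < (![l, m, n] : Fin 3 → ℤ) c <;>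
    simp [LinkDiagram.arcAt, pretzel, crossEnd, corner, below, hp] at h0 h1 <;>
    cases e <;> simp_all

/-- Whether the top arc from the column `c` to the next column points to the right. -/
def topArc (c : Fin 3) : Bool := o.into (Sum.inr ((true, c), 0))

theorem up_top (c : Fin 3) : up o ⟨c, (Fin.last _, true)⟩ = topArc o c := by
  rw [topArc, into_eq]
  simp [LinkDiagram.arcAt, pretzel, joinEnd, below]

theorem up_top_left (c : Fin 3) : up o ⟨c + 1, (Fin.last _, false)⟩ = !topArc o c := by
  have h := o.join_opposite (true, c)
  rw [into_eq] at h
  refine Eq.trans ?_ h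
  simp [LinkDiagram.arcAt, pretzel, joinEnd, below]

/-- A crossing exchanges the directions on the two sides, so being parallel or antiparallel is a
property of the whole column. -/
theorem up_right_eq_left_iff (c : Fin 3) (h : Fin (((![l, m, n] : Fin 3 → ℤ) c).natAbs + 1)) :
    up o ⟨c, (h, true)⟩ = up o ⟨c, (h, false)⟩ ↔
      up o ⟨c, (Fin.last _, true)⟩ = up o ⟨c, (Fin.last _, false)⟩ := by
  induction h using Fin.reverseInduction with
  | last => rfl
  | cast k ih =>
    rw [← ih, up_succ, up_succ]
    exact eq_comm

/-- A crossing of a right-handed column is positive if the strands of the column are parallel, a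
crossing of a left-handed column if they are antiparallel. -/
theorem isPositive_iff (c : Fin 3) (k : Fin ((![l, m, n] : Fin 3 → ℤ) c).natAbs) :
    o.IsPositive ⟨c, k⟩ ↔ (0 < (![l, m, n] : Fin 3 → ℤ) c ↔
      topArc o c ≠ topArc o (c - 1)) := by
  have h1 := up_right_eq_left_iff o c k.castSucc
  have h2 := up_succ o c k
  have hc := up_top_left o (c - 1)
  rw [sub_add_cancel] at hc
  rw [up_top, hc] at h1
  have h3 : (topArc o c = !topArc o (c - 1)) ↔ topArc o c ≠ topArc o (c - 1) := by
    cases topArc o c <;> cases topArc o (c - 1) <;> simp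
  rw [← h3, ← h1]
  change o.into (Sum.inl (⟨c, k⟩, 0)) ≠ o.into (Sum.inl (⟨c, k⟩, 1)) ↔ _
  rw [into_eq, into_eq]
  by_cases hp : 0 < (![l, m, n] : Fin 3 → ℤ) c <;>
    simp [LinkDiagram.arcAt, pretzel, crossEnd, corner, below, hp, h2]
  grind

theorem card_filter_crossing (P : (pretzel l m n).Crossing → Prop) {_ : DecidablePred P}
    (Q : Fin 3 → Prop) [DecidablePred Q] (h : ∀ c k, P ⟨c, k⟩ ↔ Q c) :
    (Finset.univ.filter P).card = (if Q 0 then l.natAbs else 0) + (if Q 1 then m.natAbs else 0) +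
      if Q 2 then n.natAbs else 0 := by
  have key : (Finset.univ.filter P).card = ∑ c, ∑ k : Fin ((![l, m, n] : Fin 3 → ℤ) c).natAbs,
      if Q c then 1 else 0 := by
    rw [Finset.card_filter]
    refine (Fintype.sum_sigma _).trans
      (Finset.sum_congr rfl fun c _ => Finset.sum_congr rfl fun k _ => ?_)
    by_cases hq : Q c
    · exact (if_pos ((h c k).2 hq)).trans (if_pos hq).symm
    · exact (if_neg (mt (h c k).1 hq)).trans (if_neg hq).symm
  have hcol : ∀ c, (∑ k : Fin ((![l, m, n] : Fin 3 → ℤ) c).natAbs, if Q c then 1 else 0) =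
      if Q c then ((![l, m, n] : Fin 3 → ℤ) c).natAbs else 0 := by
    intro c
    split_ifs <;> simp
  rw [key, Fin.sum_univ_three, hcol, hcol, hcol]
  rfl

theorem numPos_eq : o.numPos =
    (if 0 < l ↔ topArc o 0 ≠ topArc o 2 then l.natAbs else 0) +
    (if 0 < m ↔ topArc o 1 ≠ topArc o 0 then m.natAbs else 0) +
    (if 0 < n ↔ topArc o 2 ≠ topArc o 1 then n.natAbs else 0) := by
  refine (card_filter_crossing _ _ (isPositive_iff o)).trans ?_
  congr!

theorem numNeg_eq : o.numNeg =
    (if ¬(0 < l ↔ topArc o 0 ≠ topArc o 2) then l.natAbs else 0) +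
    (if ¬(0 < m ↔ topArc o 1 ≠ topArc o 0) then m.natAbs else 0) +
    (if ¬(0 < n ↔ topArc o 2 ≠ topArc o 1) then n.natAbs else 0) := by
  refine (card_filter_crossing (fun x => ¬ o.IsPositive x)
    (fun c => ¬(0 < (![l, m, n] : Fin 3 → ℤ) c ↔ topArc o c ≠ topArc o (c - 1)))
    fun c k => not_congr (isPositive_iff o c k)).trans ?_
  congr!

theorem exists_isLR (l m : ℤ) : ∃ o : (pretzel l m 0).Orientation, IsLR o := by
  -- Column 0 runs down, column 1 runs up, and in column 2 only the right strand runs up.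
  refine ⟨orientationOfUp (fun a => if a.1 = 2 then a.2.2 else decide (a.1 = 1)) ?_ ?_ ?_,
    rfl, rfl, rfl⟩
  · intro c k e
    fin_cases c
    · rfl
    · rfl
    · exact Fin.elim0 k
  all_goals
    intro c
    fin_cases c <;> rfl

theorem exists_isRL {l : ℤ} (hl : Even l) (m : ℤ) :
    ∃ o : (pretzel l m 0).Orientation, IsRL o := by
  have hl' : ¬ Odd l.natAbs := by simpa using hl
  -- In the antiparallel column 0 the upward strand changes sides at each crossing. Evenness of `l`
  -- makes its positions at the top and the bottom agree, as the outer arcs require.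
  refine ⟨orientationOfUp (fun a => if a.1 = 0 then xor a.2.2 (decide (Odd (a.2.1 : ℕ)))
    else decide (a.1 = 2)) ?_ ?_ ?_, rfl, ?_, rfl⟩
  · intro c k e
    fin_cases c
    · change xor e (decide (Odd ((k : ℕ) + 1))) = xor (!e) (decide (Odd (k : ℕ)))
      by_cases hk : Odd (k : ℕ) <;> cases e <;> simp [hk, Nat.odd_add_one]
    · rfl
    · exact Fin.elim0 k
  · intro c
    fin_cases c
    · change false = !(xor true (decide (Odd l.natAbs)))
      simp [hl']
    · rfl
    · change xor false (decide (Odd l.natAbs)) = false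
      simp [hl']
  · intro c
    fin_cases c <;> rfl
  · change xor (xor true (decide (Odd l.natAbs))) false = true
    simp [hl']

end Orientation
end Pretzel

/-! ### Closed forms and division by `q + q⁻¹`. -/

section Algebra

theorem sum_geometric_mul {R : Type*} [CommRing R] (a r : R) (n : ℕ) :
    (1 + r) * ∑ j ∈ Finset.Icc 1 n, (-1) ^ (j + 1) * (a * r ^ j) =
      a * r - (-1) ^ n * (a * r ^ (n + 1)) := by
  induction n with
  | zero => simp
  | succ n ih => rw [Finset.sum_Icc_succ_top (by omega), mul_add, ih]; ring

end Algebra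

namespace Pretzel

theorem circle_ne_zero : (T 1 + T (-1) : ℤ[T;T⁻¹]) ≠ 0 := by
  intro h
  have := congrArg (fun f : ℤ[T;T⁻¹] => f.coeff 1) h
  simp at this

theorem T_mul_natCast (k : ℤ) (n : ℕ) : (T (k * n) : ℤ[T;T⁻¹]) = T k ^ n := by
  rw [T_pow, mul_comm]

theorem circle_mul_column_left (l : ℕ) :
    (T 1 + T (-1)) * columnSum (-T 1 : ℤ[T;T⁻¹]) (T 1 + T (-1)) false l =
      T (-l) + (-1) ^ l * T l * (T 2 + 1 + T (-2)) := by
  rw [mul_columnSum]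
  have h1 : (T 1 * T (-1) : ℤ[T;T⁻¹]) = 1 := by rw [← T_add]; simp
  have e1 : (T (-l) : ℤ[T;T⁻¹]) = T (-1) ^ l := by rw [T_pow]; simp
  have e2 : (T l : ℤ[T;T⁻¹]) = T 1 ^ l := by rw [T_pow]; simp
  have e3 : (T 2 : ℤ[T;T⁻¹]) = T 1 ^ 2 := by rw [T_pow]; simp
  have e4 : (T (-2) : ℤ[T;T⁻¹]) = T (-1) ^ 2 := by rw [T_pow]; simp
  rw [e1, e2, e3, e4, ← mul_pow]
  simp only [Bool.false_eq_true, if_false]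
  rw [show (T 1 + T (-1) + -T 1 : ℤ[T;T⁻¹]) = T (-1) by ring]
  linear_combination 2 * (-1 * T 1) ^ l * h1

theorem circle_mul_column_right (l : ℕ) :
    (T 1 + T (-1)) * columnSum (-T 1 : ℤ[T;T⁻¹]) (T 1 + T (-1)) true l =
      (-1) ^ l * T (2 * l) + (T 2 + 1 + T (-2)) := by
  rw [mul_columnSum]
  have h1 : (T 1 * T (-1) : ℤ[T;T⁻¹]) = 1 := by rw [← T_add]; simp
  have e3 : (T 2 : ℤ[T;T⁻¹]) = T 1 ^ 2 := by rw [T_pow]; simp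
  have e4 : (T (-2) : ℤ[T;T⁻¹]) = T (-1) ^ 2 := by rw [T_pow]; simp
  rw [T_mul_natCast, ← mul_pow, e3, e4]
  simp only [if_true, one_pow, mul_one]
  rw [show (1 + -T 1 * (T 1 + T (-1)) : ℤ[T;T⁻¹]) = -1 * T 1 ^ 2 by linear_combination -h1]
  linear_combination 2 * h1

theorem circle_sq_mul_bracket (l : ℕ) (hl : 0 < l) :
    (T 1 + T (-1)) ^ 2 * (pretzel (-l) l 0).bracket =
      (T (-l) + (-1) ^ l * T l * (T 2 + 1 + T (-2))) *
        ((-1) ^ l * T (2 * l) + (T 2 + 1 + T (-2))) := by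
  rw [bracket_pretzel, ← circle_mul_column_left, ← circle_mul_column_right]
  simp only [Int.natAbs_neg, Int.natAbs_natCast]
  rw [decide_eq_false (by omega), decide_eq_true (by omega)]
  ring

/-- The value of the unnormalized Jones polynomial at the orientation `LR`. -/
noncomputable def jonesLR (l : ℕ) : ℤ[T;T⁻¹] :=
  (T 1 + T (-1)) * ((-1) ^ l * T (-l) * (pretzel (-l) l 0).bracket)

theorem circle_mul_jonesLR (l : ℕ) (hl : 0 < l) :
    (T 1 + T (-1)) * jonesLR l =
      1 + (-1) ^ l * (T (2 * l) + T (-2 * l)) * (T 2 + 1 + T (-2)) + (T 2 + 1 + T (-2)) ^ 2 := by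
  have hs : ((-1 : ℤ[T;T⁻¹]) ^ l) * (-1) ^ l = 1 := by rw [← mul_pow]; simp
  have h1 : (T (-l) * T l : ℤ[T;T⁻¹]) = 1 := by rw [← T_add]; simp
  have h2 : (T (-l) * T (-l) : ℤ[T;T⁻¹]) = T (-2 * l) := by rw [← T_add]; congr 1; ring
  have h3 : (T l * T l : ℤ[T;T⁻¹]) = T (2 * l) := by rw [← T_add]; congr 1; ring
  have hb := circle_sq_mul_bracket l hl
  have : (T 1 + T (-1)) * jonesLR l =
      (-1) ^ l * T (-l) * ((T 1 + T (-1)) ^ 2 * (pretzel (-l) l 0).bracket) := by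
    unfold jonesLR; ring
  -- Only `s² = 1` and `uv = 1` are needed from here on, so the powers are replaced by variables.
  rw [this, hb, ← h2, ← h3]
  generalize (-1 : ℤ[T;T⁻¹]) ^ l = s at *
  generalize (T (-l) : ℤ[T;T⁻¹]) = u at *
  generalize (T l : ℤ[T;T⁻¹]) = v at *
  generalize (T 2 + 1 + T (-2) : ℤ[T;T⁻¹]) = w at *
  linear_combination ((u * v) ^ 2 + s * v ^ 2 * w * u * v + w ^ 2 * u * v) * hs
    + (u * v + 1 + s * v ^ 2 * w + w ^ 2) * h1

theorem jonesLR_eq (l : ℕ) (hl : 3 ≤ l) : jonesLR l =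
    (-1) ^ l * T (2 * (l : ℤ) + 1)
      + ∑ j ∈ Finset.Icc 1 (l - 3), (-1) ^ (j + l + 1) * T (2 * (l : ℤ) - 2 * (j : ℤ) - 1)
      + (2 * T 1 + 2 * T (-1))
      + ∑ i ∈ Finset.Icc 1 (l - 3), (-1) ^ (i + 1) * T (-2 * (i : ℤ) - 3)
      + (-1) ^ l * T (-2 * (l : ℤ) - 1) := by
  apply mul_left_cancel₀ circle_ne_zero
  rw [circle_mul_jonesLR l (by omega)]
  -- This substitution removes the truncated subtraction; both sums become geometric with ratio
  -- `-q⁻²`.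
  obtain ⟨k, rfl⟩ : ∃ k, l = k + 3 := ⟨l - 3, by omega⟩
  rw [Nat.add_sub_cancel]
  have e1 : ∑ j ∈ Finset.Icc 1 k, (-1) ^ (j + (k + 3) + 1) *
      T (2 * ((k + 3 : ℕ) : ℤ) - 2 * (j : ℤ) - 1) = (-1 : ℤ[T;T⁻¹]) ^ (k + 3) *
      ∑ j ∈ Finset.Icc 1 k, (-1) ^ (j + 1) * (T (2 * (k : ℤ) + 5) * T (-2) ^ j) := by
    rw [Finset.mul_sum]
    refine Finset.sum_congr rfl fun j _ => ?_
    rw [T_pow, ← T_add, ← mul_assoc, ← pow_add]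
    congr 2
    · ring
    · push_cast; ring
  have e2 : ∑ j ∈ Finset.Icc 1 k, (-1) ^ (j + 1) * T (-2 * (j : ℤ) - 3) =
      ∑ j ∈ Finset.Icc 1 k, (-1 : ℤ[T;T⁻¹]) ^ (j + 1) * (T (-3) * T (-2) ^ j) := by
    refine Finset.sum_congr rfl fun j _ => ?_
    rw [T_pow, ← T_add]
    congr 2
    ring
  have g1 := sum_geometric_mul (T (2 * (k : ℤ) + 5) : ℤ[T;T⁻¹]) (T (-2)) k
  have g2 := sum_geometric_mul (T (-3) : ℤ[T;T⁻¹]) (T (-2)) k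
  rw [e1, e2]
  generalize ∑ j ∈ Finset.Icc 1 k, (-1 : ℤ[T;T⁻¹]) ^ (j + 1) *
    (T (2 * (k : ℤ) + 5) * T (-2) ^ j) = A at *
  generalize ∑ j ∈ Finset.Icc 1 k, (-1 : ℤ[T;T⁻¹]) ^ (j + 1) * (T (-3) * T (-2) ^ j) = B at *
  have hxy : (T 1 * T (-1) : ℤ[T;T⁻¹]) = 1 := by rw [← T_add]; simp
  have hs : ((-1 : ℤ[T;T⁻¹]) ^ k) * (-1) ^ k = 1 := by rw [← mul_pow]; simp
  have m : ∀ a b c : ℤ, a + b = c → (T a * T b : ℤ[T;T⁻¹]) = T c := by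
    rintro a b c rfl
    exact (T_add a b).symm
  rw [T_pow, m _ _ (2 * (k : ℤ) + 3) (by ring), m _ _ 3 (by push_cast; ring)] at g1
  rw [T_pow, m _ _ (-5) (by ring), m _ _ (-2 * (k : ℤ) - 5) (by push_cast; ring)] at g2
  rw [show 2 * ((k + 3 : ℕ) : ℤ) = 2 * k + 6 by push_cast; ring,
    show -2 * ((k + 3 : ℕ) : ℤ) = -2 * k - 6 by push_cast; ring, pow_add]
  have c1 := m 1 (-2) (-1) (by ring)
  have c2 := m 1 1 2 (by ring)
  have c3 := m (-1) (-1) (-2) (by ring)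
  have c4 := m 2 2 4 (by ring)
  have c5 := m (-2) (-2) (-4) (by ring)
  have c6 : (T 2 * T (-2) : ℤ[T;T⁻¹]) = 1 := by rw [← T_add]; simp
  have p1 := m (2 * k + 6) 2 (2 * k + 8) (by ring)
  have p2 := m (2 * k + 6) (-2) (2 * k + 4) (by ring)
  have p3 := m (-2 * k - 6) 2 (-2 * k - 4) (by ring)
  have p4 := m (-2 * k - 6) (-2) (-2 * k - 8) (by ring)
  have q1 := m 1 (2 * k + 6 + 1) (2 * k + 8) (by ring)
  have q2 := m (-1) (2 * k + 6 + 1) (2 * k + 6) (by ring)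
  have q3 := m 1 (-2 * k - 6 - 1) (-2 * k - 6) (by ring)
  have q4 := m (-1) (-2 * k - 6 - 1) (-2 * k - 8) (by ring)
  have r1 := m 1 (2 * k + 3) (2 * k + 4) (by ring)
  have r2 := m 1 3 4 (by ring)
  have r3 := m 1 (-5) (-4) (by ring)
  have r4 := m 1 (-2 * k - 5) (-2 * k - 4) (by ring)
  generalize (-1 : ℤ[T;T⁻¹]) ^ k = s at *
  -- As `q + q⁻¹ = q (1 + q⁻²)`, multiplying the telescoped identity by `q` gives the product with
  -- `δ`.
  have hA : (T 1 + T (-1)) * A = T (2 * k + 4) - s * T 4 := by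
    linear_combination T 1 * g1 - c1 * A + r1 - s * r2
  have hB : (T 1 + T (-1)) * B = T (-4) - s * T (-2 * k - 4) := by
    linear_combination T 1 * g2 - c1 * B + r3 - s * r4
  linear_combination s * hA - hB - T 4 * hs - s * (p1 + p2 + p3 + p4) + c4 + c5 + 2 * c6
    + s * (q1 + q2 + q3 + q4) - 2 * c2 - 2 * c3 - 4 * hxy

theorem unnormalizedJones_of_isLR {l : ℕ} (hl : 0 < l)
    {o : (pretzel (-(l : ℤ)) l 0).Orientation} (ho : IsLR o) :
    o.unnormalizedJones = jonesLR l := by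
  obtain ⟨h2, h0, h1⟩ : topArc o 2 = true ∧ topArc o 0 = false ∧ topArc o 1 = true := ho
  -- Both columns are parallel, so the right-handed one is positive and the left-handed one
  -- negative.
  have hp : o.numPos = l := by
    rw [numPos_eq, h0, h1, h2]; simp [hl]
  have hn : o.numNeg = l := by
    rw [numNeg_eq, h0, h1, h2]; simp [hl]
  rw [LinkDiagram.Orientation.unnormalizedJones, LinkDiagram.Orientation.jones, hp, hn, jonesLR]
  congr 4
  ring

theorem unnormalizedJones_of_isRL {l : ℕ} (hl : 0 < l) (hl' : Even l)
    {o : (pretzel (-(l : ℤ)) l 0).Orientation} (ho : IsRL o) :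
    o.unnormalizedJones = T (3 * l) * jonesLR l := by
  obtain ⟨h2, h0, h1⟩ : topArc o 2 = true ∧ topArc o 0 = true ∧ topArc o 1 = false := ho
  -- Making the left-handed column antiparallel turns its crossings positive.
  have hp : o.numPos = 2 * l := by
    rw [numPos_eq, h0, h1, h2]; simp [hl]; omega
  have hn : o.numNeg = 0 := by
    rw [numNeg_eq, h0, h1, h2]; simp [hl]
  have hT : (T (2 * l) : ℤ[T;T⁻¹]) = T (3 * l) * T (-l) := by
    rw [← T_add]; congr 1; ring
  rw [LinkDiagram.Orientation.unnormalizedJones, LinkDiagram.Orientation.jones, hp, hn, jonesLR,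
    hl'.neg_one_pow]
  rw [show ((2 * l : ℕ) : ℤ) - 2 * ((0 : ℕ) : ℤ) = 2 * l by push_cast; ring, hT]
  ring

/-- The general formula fails here: its sums would have to run from 1 to -1, which for a geometric
sum means minus the term of index 0. This accounts for the extra `q³` and `q⁻³`. -/
theorem jonesLR_two : jonesLR 2 = T 5 + T 3 + (2 * T 1 + 2 * T (-1)) + T (-3) + T (-5) := by
  apply mul_left_cancel₀ circle_ne_zero
  rw [circle_mul_jonesLR 2 (by omega)]
  have m : ∀ a b c : ℤ, a + b = c → (T a * T b : ℤ[T;T⁻¹]) = T c := by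
    rintro a b c rfl
    exact (T_add a b).symm
  have c6 : (T 2 * T (-2) : ℤ[T;T⁻¹]) = 1 := by rw [← T_add]; simp
  have hxy : (T 1 * T (-1) : ℤ[T;T⁻¹]) = 1 := by rw [← T_add]; simp
  rw [show (2 * ((2 : ℕ) : ℤ)) = 4 by norm_num, show (-2 * ((2 : ℕ) : ℤ)) = -4 by norm_num]
  linear_combination m 4 2 6 rfl + m 4 (-2) 2 rfl + m (-4) 2 (-2) rfl + m (-4) (-2) (-6) rfl
    + m 2 2 4 rfl + m (-2) (-2) (-4) rfl + 2 * c6 - m 1 5 6 rfl - m 1 3 4 rfl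
    - 2 * m 1 1 2 rfl - 4 * hxy - m 1 (-3) (-2) rfl - m 1 (-5) (-4) rfl - m (-1) 5 4 rfl
    - m (-1) 3 2 rfl - 2 * m (-1) (-1) (-2) rfl - m (-1) (-3) (-4) rfl - m (-1) (-5) (-6) rfl

end Pretzel

theorem mainTheorem6 (l : ℕ) (hl : 2 ≤ l) :
    (∃ o : (pretzel (-(l : ℤ)) l 0).Orientation, IsLR o) ∧
    (∀ o : (pretzel (-(l : ℤ)) l 0).Orientation, IsLR o →
      (3 ≤ l → o.unnormalizedJones =
        (-1) ^ l * T (2 * (l : ℤ) + 1)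
          + ∑ j ∈ Finset.Icc 1 (l - 3), (-1) ^ (j + l + 1) * T (2 * (l : ℤ) - 2 * (j : ℤ) - 1)
          + (2 * T 1 + 2 * T (-1))
          + ∑ i ∈ Finset.Icc 1 (l - 3), (-1) ^ (i + 1) * T (-2 * (i : ℤ) - 3)
          + (-1) ^ l * T (-2 * (l : ℤ) - 1)) ∧
      (l = 2 → o.unnormalizedJones =
        T 5 + T 3 + (2 * T 1 + 2 * T (-1)) + T (-3) + T (-5))) ∧
    (Even l → ∃ o : (pretzel (-(l : ℤ)) l 0).Orientation, IsRL o) ∧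
    (∀ o : (pretzel (-(l : ℤ)) l 0).Orientation, Even l → IsRL o →
      (3 ≤ l → o.unnormalizedJones =
        (-1) ^ l * T (5 * (l : ℤ) + 1)
          + ∑ j ∈ Finset.Icc 1 (l - 3), (-1) ^ (j + l + 1) * T (5 * (l : ℤ) - 2 * (j : ℤ) - 1)
          + (2 * T (3 * (l : ℤ) + 1) + 2 * T (3 * (l : ℤ) - 1))
          + ∑ i ∈ Finset.Icc 1 (l - 3), (-1) ^ (i + 1) * T (3 * (l : ℤ) - 2 * (i : ℤ) - 3)
          + (-1) ^ l * T ((l : ℤ) - 1)) ∧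
      (l = 2 → o.unnormalizedJones =
        T 11 + T 9 + (2 * T 7 + 2 * T 5) + T 3 + T 1)) := by
  have hpos : 0 < l := by omega
  refine ⟨Pretzel.exists_isLR _ _, fun o ho => ?_,
    fun he => Pretzel.exists_isRL (by simpa using he) _, fun o he ho => ?_⟩
  · rw [Pretzel.unnormalizedJones_of_isLR hpos ho]
    refine ⟨Pretzel.jonesLR_eq l, ?_⟩
    rintro rfl
    exact Pretzel.jonesLR_two
  · rw [Pretzel.unnormalizedJones_of_isRL hpos he ho]
    refine ⟨fun h3 => ?_, ?_⟩
    · rw [Pretzel.jonesLR_eq l h3]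
      simp only [mul_add, Finset.mul_sum, mul_left_comm (T (3 * (l : ℤ)) : ℤ[T;T⁻¹]), ← T_add]
      ring_nf
    · rintro rfl
      rw [Pretzel.jonesLR_two]
      simp only [mul_add, mul_left_comm (T _ : ℤ[T;T⁻¹]) 2, ← T_add]
      norm_num
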